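/- A weighted IFS on $\mathbb{R}$ consists of $N\ge 2$ distinct maps $S_j(x)=r_jx+b_j$ with $b_j\in\mathbb{R}$, $0<|r_j|<1$, and weights $p_j>0$ with $\sum_{j=1}^N p_j=1$. It is homogeneous if all $r_j$ equal a common ratio $r$. Its attractor is the unique non-empty compact $K\subset\mathbb{R}$ with $K=\bigcup_{j} S_j(K)$; its self-similar measure is the unique Borel probability measure $\mu$ on $\mathbb{R}$ with $\mu=\sum_{j} p_j\,\mu\circ S_j^{-1}$, and the weighted IFS is then called a generating weighted IFS of $\mu$. Its exponential polynomial is $f(z)=\sum_{j=1}^N p_j e^{b_j z}$, $z\in\mathbb{C}$. Theorem 1.3. Suppose that a homogeneous weighted IFS $(\Phi,\mathbf{p})$ satisfies condition (Z), that is, at least one of the following holds: (i) its attractor $K$ satisfies the no-interval condition: $[\min K,\min K+\varepsilon]\not\subset K$ for every $\varepsilon>0$ (this holds in particular if $K$ contains no non-degenerate interval); (ii) its exponential polynomial $f$ has a complex zero $z$ that is not purely imaginary, that is, $f(z)=0$ and $\operatorname{Re} z\neq 0$. Then its self-similar measure $\mu$ satisfies condition (HLC): for any two homogeneous generating weighted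 IFSs of $\mu$, with common ratios $r_1$ and $r_2$, there is $q\in\mathbb{Q}$ with $|r_1|=|r_2|^q$. -/

import Mathlib

open MeasureTheory

/-- A (standard) weighted iterated function system on the real line: `N ≥ 2` distinct contractive
similitudes `x ↦ r_j x + b_j` with `0 < |r_j| < 1`, together with a strictly positive probability
vector `(p_j)`. -/
structure WeightedIFS where
  /-- The number of maps. -/
  N : ℕ
  two_le : 2 ≤ N
  /-- The contraction ratios `r_j` (possibly negative). -/
  ratio : Fin N → ℝ
  /-- The translations `b_j`. -/
  trans : Fin N → ℝ
  /-- The probability weights `p_j`. -/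
  weight : Fin N → ℝ
  ratio_ne_zero : ∀ j, ratio j ≠ 0
  abs_ratio_lt_one : ∀ j, |ratio j| < 1
  /-- The maps `x ↦ r_j x + b_j` are pairwise distinct. -/
  distinct : Function.Injective fun j => (ratio j, trans j)
  weight_pos : ∀ j, 0 < weight j
  weight_sum : ∑ j, weight j = 1

namespace WeightedIFS

/-- The `j`-th map `S_j(x) = r_j x + b_j`. -/
def map (Φ : WeightedIFS) (j : Fin Φ.N) (x : ℝ) : ℝ := Φ.ratio j * x + Φ.trans j

/-- `Φ` is homogeneous with common contraction ratio `r`. -/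
def HasCommonRatio (Φ : WeightedIFS) (r : ℝ) : Prop := ∀ j, Φ.ratio j = r

/-- `Φ` is homogeneous: all contraction ratios are equal. -/
def IsHomogeneous (Φ : WeightedIFS) : Prop := ∃ r, Φ.HasCommonRatio r

/-- `K` is the attractor of `Φ`: the non-empty compact set with `K = ⋃ j, S_j(K)`. -/
def IsAttractor (Φ : WeightedIFS) (K : Set ℝ) : Prop :=
  IsCompact K ∧ K.Nonempty ∧ K = ⋃ j, Φ.map j '' K

/-- `μ` is the self-similar measure of `Φ`, i.e. `Φ` is a generating weighted IFS of `μ`: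
`μ` is a Borel probability measure with `μ = ∑ j, p_j · (μ ∘ S_j⁻¹)`. -/
def IsSelfSimilarMeasure (Φ : WeightedIFS) (μ : Measure ℝ) : Prop :=
  IsProbabilityMeasure μ ∧
    μ = ∑ j, ENNReal.ofReal (Φ.weight j) • Measure.map (Φ.map j) μ

/-- The exponential polynomial of `Φ`, with real frequencies and normalized positive coefficients:
`z ↦ ∑ j, p_j e^{b_j z}`. The function `m(ξ) = ∑ j, p_j e^{-2πi b_j ξ}` is its value at
`z = -2πiξ`. -/
noncomputable def expPoly (Φ : WeightedIFS) (z : ℂ) : ℂ :=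
  ∑ j, (Φ.weight j : ℂ) * Complex.exp ((Φ.trans j : ℂ) * z)

end WeightedIFS

/-- The no-interval condition for a non-empty compact set `K ⊆ ℝ`: no interval
`[min K, min K + ε]` with `ε > 0` is contained in `K`. It holds in particular if `K` contains no
non-degenerate interval at all. -/
def NoIntervalCondition (K : Set ℝ) : Prop :=
  ∀ ε : ℝ, 0 < ε → ¬ Set.Icc (sInf K) (sInf K + ε) ⊆ K

/-- Condition (Z): the attractor satisfies the no-interval condition, or the exponential polynomial
has a complex zero that is not purely imaginary. -/
def WeightedIFS.ConditionZ (Φ : WeightedIFS) : Prop :=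
  (∃ K : Set ℝ, Φ.IsAttractor K ∧ NoIntervalCondition K) ∨
    ∃ z : ℂ, Φ.expPoly z = 0 ∧ z.re ≠ 0

/-- Condition (HLC), homogeneous logarithmic commensurability: the absolute values of the common
contraction ratios of the homogeneous generating weighted IFSs of `μ` are rational powers of one
another. -/
def HLC (μ : Measure ℝ) : Prop :=
  ∀ (Ψ₁ Ψ₂ : WeightedIFS) (r₁ r₂ : ℝ),
    Ψ₁.IsSelfSimilarMeasure μ → Ψ₂.IsSelfSimilarMeasure μ →
    Ψ₁.HasCommonRatio r₁ → Ψ₂.HasCommonRatio r₂ →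
    ∃ q : ℚ, |r₁| = |r₂| ^ (q : ℝ)

/-!
The data that a homogeneous system with ratio `r` puts on `μ` are scaling relations, and condition
(Z) singles out an object attached to `μ` alone on which two incommensurable scalings cannot both
act. In both cases one compares the two given systems directly; the system satisfying (Z) only
serves to show that `μ` has the relevant property.

*No interval at the minimum.* The attractor of every homogeneous generating system is the support
of `μ` (`WeightedIFS.IsSelfSimilarMeasure.support_eq_of_isAttractor`). If `a` is the minimum of the
support, then near `a` only the pieces whose own minimum is `a` are visible, so the germ of the
support at `a` is invariant under the homothety of ratio `r ^ 2` (`eventually_mem_homothety_iff`).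
The logarithms of the ratios of all homotheties preserving this germ form a subgroup of `ℝ`, which
is dense or cyclic. If it is dense, the support contains an interval starting at `a`
(`exists_Icc_subset_of_dense_germScaling`); if it is cyclic, the logarithms of any two ratios are
commensurable.

*A zero off the imaginary axis.* The Laplace transform `M z = ∫ exp (z x) dμ` is finite everywhere
since `μ` has compact support, and satisfies `M z = f z * M (r z)` for the exponential polynomial `f`
of every generating system of ratio `r`. So a zero `z` of `f` is a zero of `M`, and then all the
`r₁⁻¹ ^ k * z` are zeros of `M`. Each of them is moved by some power of `r₂` to a zero of the
exponential polynomial of the second system, because `M 0 = 1`. All of this happens on the real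
line through `z`; as `re z ≠ 0`, the exponential polynomial has only finitely many zeros there
(`WeightedIFS.HasCommonRatio.finite_expPoly_zeros`), and the pigeonhole principle yields
`r₂ ^ l * r₁⁻¹ ^ k = r₂ ^ l' * r₁⁻¹ ^ k'` with `k ≠ k'`.
-/

open Filter Topology

namespace WeightedIFS

variable {Φ : WeightedIFS} {r : ℝ} {μ : Measure ℝ}

/-! ### The support of a homogeneous self-similar measure -/

lemma HasCommonRatio.ne_zero (hr : Φ.HasCommonRatio r) : r ≠ 0 :=
  hr ⟨0, by have := Φ.two_le; omega⟩ ▸ Φ.ratio_ne_zero _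

lemma HasCommonRatio.abs_lt_one (hr : Φ.HasCommonRatio r) : |r| < 1 :=
  hr ⟨0, by have := Φ.two_le; omega⟩ ▸ Φ.abs_ratio_lt_one _

lemma HasCommonRatio.map_apply (hr : Φ.HasCommonRatio r) (j : Fin Φ.N) (x : ℝ) :
    Φ.map j x = r * x + Φ.trans j := by
  rw [WeightedIFS.map, hr j]

lemma HasCommonRatio.trans_injective (hr : Φ.HasCommonRatio r) :
    Function.Injective Φ.trans := fun i j h =>
  Φ.distinct (by simp [hr i, hr j, h])

lemma continuous_map (Φ : WeightedIFS) (j : Fin Φ.N) : Continuous (Φ.map j) := by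
  unfold WeightedIFS.map
  fun_prop

lemma IsSelfSimilarMeasure.measure_apply (hμ : Φ.IsSelfSimilarMeasure μ) {A : Set ℝ}
    (hA : MeasurableSet A) :
    μ A = ∑ j, ENNReal.ofReal (Φ.weight j) * μ (Φ.map j ⁻¹' A) := by
  conv_lhs => rw [hμ.2]
  simp [Measure.map_apply (Φ.continuous_map _).measurable hA]

lemma sum_ofReal_weight (Φ : WeightedIFS) : ∑ j, ENNReal.ofReal (Φ.weight j) = 1 := by
  rw [← ENNReal.ofReal_sum_of_nonneg fun j _ => (Φ.weight_pos j).le, Φ.weight_sum,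
    ENNReal.ofReal_one]

lemma HasCommonRatio.infDist_map_le (hr : Φ.HasCommonRatio r) {K : Set ℝ} (hK : IsClosed K)
    (hne : K.Nonempty) {j : Fin Φ.N} (hmaps : Set.MapsTo (Φ.map j) K K) (x : ℝ) :
    Metric.infDist (Φ.map j x) K ≤ |r| * Metric.infDist x K := by
  obtain ⟨y, hy, hxy⟩ := hK.exists_infDist_eq_dist hne x
  rw [hxy]
  refine (Metric.infDist_le_dist_of_mem (hmaps hy)).trans_eq ?_
  rw [hr.map_apply, hr.map_apply, Real.dist_eq, Real.dist_eq, ← abs_mul]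
  congr 1
  ring

/-- A homogeneous self-similar measure is carried by every non-empty closed set that the maps
leave invariant: the tail of the distance to that set satisfies `F s ≤ F (s / |r|)`, hence
vanishes at every `s > 0`. -/
lemma IsSelfSimilarMeasure.ae_mem_of_mapsTo (hμ : Φ.IsSelfSimilarMeasure μ)
    (hr : Φ.HasCommonRatio r) {K : Set ℝ} (hK : IsClosed K) (hne : K.Nonempty)
    (hmaps : ∀ j, Set.MapsTo (Φ.map j) K K) : ∀ᵐ x ∂μ, x ∈ K := by
  have := hμ.1
  have hr0 : 0 < |r| := abs_pos.2 hr.ne_zero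
  have hmeas (s : ℝ) : MeasurableSet {x | s < Metric.infDist x K} :=
    measurableSet_lt measurable_const (Metric.continuous_infDist_pt K).measurable
  have hstep (s : ℝ) : μ {x | s < Metric.infDist x K} ≤ μ {x | s / |r| < Metric.infDist x K} := by
    rw [hμ.measure_apply (hmeas s)]
    calc ∑ j, ENNReal.ofReal (Φ.weight j) * μ (Φ.map j ⁻¹' {x | s < Metric.infDist x K})
        ≤ ∑ j, ENNReal.ofReal (Φ.weight j) * μ {x | s / |r| < Metric.infDist x K} := by
          gcongr with j
          intro x hx
          rw [Set.mem_ofPred_eq, div_lt_iff₀' hr0]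
          exact lt_of_lt_of_le hx (hr.infDist_map_le hK hne (hmaps j) x)
      _ = _ := by rw [← Finset.sum_mul, sum_ofReal_weight, one_mul]
  have hiter (s : ℝ) (n : ℕ) :
      μ {x | s < Metric.infDist x K} ≤ μ {x | s / |r| ^ n < Metric.infDist x K} := by
    induction n with
    | zero => simp
    | succ n ih =>
      refine ih.trans ((hstep _).trans_eq ?_)
      rw [div_div, ← pow_succ]
  have hdiv {s : ℝ} (hs : 0 < s) : Tendsto (fun n : ℕ => s / |r| ^ n) atTop atTop := by
    have h := tendsto_pow_atTop_atTop_of_one_lt ((one_lt_inv₀ hr0).2 hr.abs_lt_one)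
    simpa [div_eq_mul_inv] using h.const_mul_atTop hs
  have hzero {s : ℝ} (hs : 0 < s) : μ {x | s < Metric.infDist x K} = 0 := by
    have hanti : Antitone fun t : ℝ => {x : ℝ | t < Metric.infDist x K} :=
      fun a b hab x hx => lt_of_le_of_lt hab hx
    have hlim := tendsto_measure_iInter_atTop (μ := μ)
      (fun t => (hmeas t).nullMeasurableSet) hanti ⟨0, measure_ne_top _ _⟩
    have hempty : ⋂ t : ℝ, {x : ℝ | t < Metric.infDist x K} = ∅ :=
      Set.eq_empty_of_forall_notMem fun x hx =>
        lt_irrefl (Metric.infDist x K) (Set.mem_iInter.1 hx (Metric.infDist x K))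
    rw [hempty, measure_empty] at hlim
    exact le_antisymm (ge_of_tendsto' (hlim.comp (hdiv hs)) (hiter s)) zero_le
  have hall : ∀ᵐ x ∂μ, ∀ n : ℕ, ¬ (1 / ((n : ℝ) + 1) < Metric.infDist x K) :=
    ae_all_iff.2 fun n => by
      rw [ae_iff]
      simpa using hzero (Nat.one_div_pos_of_nat (α := ℝ) (n := n))
  filter_upwards [hall] with x hx
  rw [hK.mem_iff_infDist_zero hne]
  refine le_antisymm (le_of_forall_gt fun ε hε => ?_) Metric.infDist_nonneg
  obtain ⟨n, hn⟩ := exists_nat_one_div_lt hε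
  exact (not_lt.1 (hx n)).trans_lt hn

lemma HasCommonRatio.exists_mapsTo_closedBall (hr : Φ.HasCommonRatio r) :
    ∃ R : ℝ, 0 ≤ R ∧ ∀ j, Set.MapsTo (Φ.map j) (Metric.closedBall 0 R) (Metric.closedBall 0 R) := by
  set β := ∑ j, |Φ.trans j|
  have hβ : 0 ≤ β := Finset.sum_nonneg fun j _ => abs_nonneg _
  have h1 : 0 < 1 - |r| := sub_pos.2 hr.abs_lt_one
  refine ⟨β / (1 - |r|), by positivity, fun j x hx => ?_⟩
  rw [mem_closedBall_zero_iff, Real.norm_eq_abs] at hx ⊢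
  have hj : |Φ.trans j| ≤ β :=
    Finset.single_le_sum (f := fun j => |Φ.trans j|) (fun j _ => abs_nonneg _) (Finset.mem_univ j)
  rw [hr.map_apply]
  calc |r * x + Φ.trans j| ≤ |r| * |x| + |Φ.trans j| := by
        rw [← abs_mul]; exact abs_add_le _ _
    _ ≤ |r| * (β / (1 - |r|)) + β := by gcongr
    _ = β / (1 - |r|) := by field_simp; ring

lemma IsSelfSimilarMeasure.exists_ae_abs_le (hμ : Φ.IsSelfSimilarMeasure μ)
    (hr : Φ.HasCommonRatio r) : ∃ R : ℝ, ∀ᵐ x ∂μ, |x| ≤ R := by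
  obtain ⟨R, hR, hmaps⟩ := hr.exists_mapsTo_closedBall
  refine ⟨R, ?_⟩
  simpa using hμ.ae_mem_of_mapsTo hr Metric.isClosed_closedBall
    (Metric.nonempty_closedBall.2 hR) hmaps

lemma IsSelfSimilarMeasure.isCompact_support (hμ : Φ.IsSelfSimilarMeasure μ)
    (hr : Φ.HasCommonRatio r) : IsCompact μ.support := by
  obtain ⟨R, hR⟩ := hμ.exists_ae_abs_le hr
  refine (isCompact_closedBall (0 : ℝ) R).of_isClosed_subset Measure.isClosed_support ?_
  refine Measure.support_subset_of_isClosed Metric.isClosed_closedBall ?_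
  filter_upwards [hR] with x hx
  simpa using hx

lemma IsSelfSimilarMeasure.nonempty_support (hμ : Φ.IsSelfSimilarMeasure μ) :
    μ.support.Nonempty :=
  have := hμ.1
  Measure.nonempty_support (IsProbabilityMeasure.ne_zero μ)

lemma IsSelfSimilarMeasure.mapsTo_support (hμ : Φ.IsSelfSimilarMeasure μ) (j : Fin Φ.N) :
    Set.MapsTo (Φ.map j) μ.support μ.support := by
  intro x hx
  rw [(nhds_basis_opens _).mem_measureSupport]
  rintro U ⟨hxU, hU⟩
  rw [hμ.measure_apply hU.measurableSet]
  refine lt_of_lt_of_le ?_ (Finset.single_le_sum (fun _ _ => zero_le) (Finset.mem_univ j))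
  refine ENNReal.mul_pos (ENNReal.ofReal_pos.2 (Φ.weight_pos j)).ne' ?_
  exact ((Measure.mem_support_iff_forall x).1 hx _
    ((Φ.continuous_map j).continuousAt.preimage_mem_nhds (hU.mem_nhds hxU))).ne'

lemma IsSelfSimilarMeasure.isAttractor_support (hμ : Φ.IsSelfSimilarMeasure μ)
    (hr : Φ.HasCommonRatio r) : Φ.IsAttractor μ.support := by
  refine ⟨hμ.isCompact_support hr, hμ.nonempty_support, subset_antisymm ?_
    (Set.iUnion_subset fun j => (hμ.mapsTo_support j).image_subset)⟩
  have hclosed : IsClosed (⋃ j, Φ.map j '' μ.support) := isClosed_iUnion_of_finite fun j =>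
    ((hμ.isCompact_support hr).image (Φ.continuous_map j)).isClosed
  refine Measure.support_subset_of_isClosed hclosed ?_
  rw [mem_ae_iff, hμ.measure_apply hclosed.measurableSet.compl]
  refine Finset.sum_eq_zero fun j _ => ?_
  rw [measure_mono_null _ (Measure.measure_compl_support (μ := μ)), mul_zero]
  exact fun x hx hxs => hx (Set.mem_iUnion.2 ⟨j, x, hxs, rfl⟩)

/-- Uniqueness of the attractor, for the one realized as the support: the farthest point of a
compact invariant `K` from the support is the image of a point of `K`, so that the largest
distance `m` satisfies `m ≤ |r| m`. -/
lemma IsSelfSimilarMeasure.support_eq_of_isAttractor (hμ : Φ.IsSelfSimilarMeasure μ)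
    (hr : Φ.HasCommonRatio r) {K : Set ℝ} (hK : Φ.IsAttractor K) : μ.support = K := by
  obtain ⟨hKc, hKne, hKeq⟩ := hK
  refine subset_antisymm ?_ ?_
  · refine Measure.support_subset_of_isClosed hKc.isClosed
      (hμ.ae_mem_of_mapsTo hr hKc.isClosed hKne fun j x hx => ?_)
    rw [hKeq]
    exact Set.mem_iUnion.2 ⟨j, x, hx, rfl⟩
  · obtain ⟨x, hxK, hmax⟩ := hKc.exists_isMaxOn hKne
      (Metric.continuous_infDist_pt μ.support).continuousOn
    have hx' := hxK
    rw [hKeq] at hx'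
    obtain ⟨j, y, hy, rfl⟩ := Set.mem_iUnion.1 hx'
    have h1 := hr.infDist_map_le Measure.isClosed_support hμ.nonempty_support
      (hμ.mapsTo_support j) y
    have h2 : Metric.infDist y μ.support ≤ Metric.infDist (Φ.map j y) μ.support := hmax hy
    have h3 : Metric.infDist (Φ.map j y) μ.support ≤ 0 := by
      have h4 := mul_le_mul_of_nonneg_left h2 (abs_nonneg r)
      nlinarith [hr.abs_lt_one]
    intro z hz
    rw [Measure.isClosed_support.mem_iff_infDist_zero hμ.nonempty_support]
    exact le_antisymm ((hmax hz).trans h3) Metric.infDist_nonneg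

lemma IsSelfSimilarMeasure.nontrivial_support (hμ : Φ.IsSelfSimilarMeasure μ)
    (hr : Φ.HasCommonRatio r) : μ.support.Nontrivial := by
  obtain ⟨s, hs⟩ := hμ.nonempty_support
  have h2 := Φ.two_le
  refine ⟨_, hμ.mapsTo_support ⟨0, by omega⟩ hs, _, hμ.mapsTo_support ⟨1, by omega⟩ hs, ?_⟩
  rw [hr.map_apply, hr.map_apply]
  exact fun h => by simpa using hr.trans_injective (add_left_cancel h)

/-- The support is also generated by the second iterate of the system, whose ratio `r ^ 2` is
positive. -/
lemma IsSelfSimilarMeasure.mem_support_iff_sq (hμ : Φ.IsSelfSimilarMeasure μ)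
    (hr : Φ.HasCommonRatio r) (x : ℝ) :
    x ∈ μ.support ↔ ∃ i : Fin Φ.N × Fin Φ.N, ∃ y ∈ μ.support,
      x = r ^ 2 * y + (r * Φ.trans i.2 + Φ.trans i.1) := by
  have heq := (hμ.isAttractor_support hr).2.2
  constructor
  · intro hx
    rw [heq] at hx
    obtain ⟨i, y, hy, rfl⟩ := Set.mem_iUnion.1 hx
    rw [heq] at hy
    obtain ⟨j, z, hz, rfl⟩ := Set.mem_iUnion.1 hy
    refine ⟨(i, j), z, hz, ?_⟩
    rw [hr.map_apply, hr.map_apply]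
    ring
  · rintro ⟨⟨i, j⟩, z, hz, rfl⟩
    convert hμ.mapsTo_support i (hμ.mapsTo_support j hz) using 1
    rw [hr.map_apply, hr.map_apply]
    ring

end WeightedIFS

/-! ### Scaling invariance at the minimum of a self-similar set -/

/-- Near its minimum `a`, a set with `K = ⋃ i, (ρ K + b i)`, `ρ > 0`, coincides with its image
under the homothety of ratio `ρ` centred at `a`, because the pieces that do not start at `a` stay
away from `a`. -/
lemma eventually_mem_homothety_iff {ι : Type*} [Finite ι] {K : Set ℝ} {ρ a : ℝ} {b : ι → ℝ}
    (hρ : 0 < ρ) (ha : IsLeast K a) (hK : ∀ x, x ∈ K ↔ ∃ i, ∃ y ∈ K, x = ρ * y + b i) :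
    (∀ x, a + x ∈ K → a + ρ * x ∈ K) ∧ ∀ᶠ x in 𝓝[>] 0, (a + ρ * x ∈ K ↔ a + x ∈ K) := by
  have hle (i : ι) : a ≤ ρ * a + b i := ha.2 ((hK _).2 ⟨i, a, ha.1, rfl⟩)
  obtain ⟨i₀, y, hy, hay⟩ := (hK a).1 ha.1
  have hi₀ : ρ * a + b i₀ = a := by
    have := mul_le_mul_of_nonneg_left (ha.2 hy) hρ.le
    linarith [hle i₀]
  have hmap (x : ℝ) (hx : a + x ∈ K) : a + ρ * x ∈ K :=
    (hK _).2 ⟨i₀, a + x, hx, by linarith⟩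
  refine ⟨hmap, ?_⟩
  have hev : ∀ᶠ x in 𝓝[>] (0 : ℝ), ∀ i, ρ * a + b i ≠ a → ρ * x < ρ * a + b i - a := by
    refine eventually_all.2 fun i => ?_
    by_cases h : ρ * a + b i = a
    · simp [h]
    · have hpos : ρ * 0 < ρ * a + b i - a := by
        have := lt_of_le_of_ne (hle i) (Ne.symm h)
        linarith
      have hc : ContinuousAt (fun x : ℝ => ρ * x) 0 := by fun_prop
      filter_upwards [(hc.eventually_lt_const hpos).filter_mono nhdsWithin_le_nhds] with x hx _
      exact hx
  filter_upwards [hev] with x hx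
  refine ⟨fun h => ?_, hmap x⟩
  obtain ⟨i, y, hy, hxy⟩ := (hK _).1 h
  have h1 := mul_le_mul_of_nonneg_left (ha.2 hy) hρ.le
  have h2 : ρ * a + b i = a := by
    by_contra hne
    linarith [hx i hne]
  have h3 : y = a + x := mul_left_cancel₀ hρ.ne' (by linarith)
  exact h3 ▸ hy

lemma tendsto_mul_nhdsGT_zero {c : ℝ} (hc : 0 < c) :
    Tendsto (fun x : ℝ => c * x) (𝓝[>] 0) (𝓝[>] 0) := by
  refine tendsto_nhdsWithin_iff.2 ⟨?_, ?_⟩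
  · have : ContinuousAt (fun x : ℝ => c * x) 0 := by fun_prop
    simpa using this.tendsto.mono_left nhdsWithin_le_nhds
  · filter_upwards [self_mem_nhdsWithin] with x hx using mul_pos hc hx

/-- The logarithms of the ratios of those homotheties centred at `a` that preserve the right germ
of `K` at `a`. -/
def germScaling (K : Set ℝ) (a : ℝ) : AddSubgroup ℝ where
  carrier := {s | ∀ᶠ x in 𝓝[>] 0, (a + Real.exp s * x ∈ K ↔ a + x ∈ K)}
  zero_mem' := by simp
  add_mem' := by
    intro s t hs ht
    rw [Set.mem_ofPred_eq] at hs ht ⊢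
    filter_upwards [(tendsto_mul_nhdsGT_zero (Real.exp_pos t)).eventually hs, ht] with x h1 h2
    rw [Real.exp_add, mul_assoc, h1, h2]
  neg_mem' := by
    intro s hs
    rw [Set.mem_ofPred_eq] at hs ⊢
    filter_upwards [(tendsto_mul_nhdsGT_zero (Real.exp_pos (-s))).eventually hs] with x h1
    rw [← h1, ← mul_assoc, ← Real.exp_add]
    simp

/-- If the germ of `K` at `a` is preserved by a dense group of homotheties, then `K` contains an
interval `[a, a + ε]`. A small `y > 0` is a limit of points `exp s * x₀`, and
`a + exp s * x₀` lies in `K` because the homotheties of ratios `ρ ^ n` and `exp s` can be applied where the germ is invariant. -/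
lemma exists_Icc_subset_of_dense_germScaling {K : Set ℝ} {a ρ x₀ : ℝ} (hK : IsClosed K)
    (ha : a ∈ K) (hx₀ : 0 < x₀) (hx₀K : a + x₀ ∈ K) (hρ : 0 < ρ) (hρ1 : ρ < 1)
    (hmap : ∀ x, a + x ∈ K → a + ρ * x ∈ K)
    (hgerm : ∀ᶠ x in 𝓝[>] 0, (a + ρ * x ∈ K ↔ a + x ∈ K))
    (hdense : Dense (germScaling K a : Set ℝ)) : ∃ ε > 0, Set.Icc a (a + ε) ⊆ K := by
  obtain ⟨δ, hδ, hδK⟩ := (nhdsGT_basis (0 : ℝ)).eventually_iff.1 hgerm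
  have hpow (x : ℝ) (hx : a + x ∈ K) (n : ℕ) : a + ρ ^ n * x ∈ K := by
    induction n with
    | zero => simpa using hx
    | succ n ih => simpa [pow_succ', mul_assoc] using hmap _ ih
  have hunpow (n : ℕ) (x : ℝ) (hx : x ∈ Set.Ioo 0 δ) (h : a + ρ ^ n * x ∈ K) : a + x ∈ K := by
    induction n with
    | zero => simpa using h
    | succ n ih =>
      refine ih ?_
      have hn : ρ ^ n ≤ 1 := pow_le_one₀ hρ.le hρ1.le
      rw [pow_succ', mul_assoc] at h
      exact (hδK ⟨by have := hx.1; positivity, by nlinarith [hx.1, hx.2]⟩).1 h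
  have hpt (s : ℝ) (hs : s ∈ germScaling K a) (hlt : Real.exp s * x₀ < δ) :
      a + Real.exp s * x₀ ∈ K := by
    have hlim : Tendsto (fun n : ℕ => ρ ^ n * x₀) atTop (𝓝[>] 0) := by
      refine tendsto_nhdsWithin_iff.2 ⟨?_, Eventually.of_forall fun n => ?_⟩
      · simpa using (tendsto_pow_atTop_nhds_zero_of_lt_one hρ.le hρ1).mul_const x₀
      · exact mul_pos (pow_pos hρ n) hx₀
    obtain ⟨n, hn⟩ := (hlim.eventually hs).exists
    refine hunpow n _ ⟨by positivity, hlt⟩ ?_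
    rw [mul_left_comm]
    exact hn.2 (hpow x₀ hx₀K n)
  refine ⟨δ / 2, half_pos hδ, fun z hz => ?_⟩
  rcases hz.1.eq_or_lt with rfl | haz
  · exact ha
  have hy : 0 < (z - a) / x₀ := div_pos (sub_pos.2 haz) hx₀
  have hc : ContinuousAt (fun s => a + Real.exp s * x₀) (Real.log ((z - a) / x₀)) := by fun_prop
  have hval : a + Real.exp (Real.log ((z - a) / x₀)) * x₀ = z := by
    rw [Real.exp_log hy, div_mul_cancel₀ _ hx₀.ne']
    ring
  have hlt : ∀ᶠ s in 𝓝 (Real.log ((z - a) / x₀)), a + Real.exp s * x₀ < a + δ :=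
    hc.eventually_lt_const (by linarith [hz.2])
  have hfreq : ∃ᶠ s in 𝓝 (Real.log ((z - a) / x₀)), a + Real.exp s * x₀ ∈ K :=
    ((mem_closure_iff_frequently.1 (hdense _)).and_eventually hlt).mono
      fun s hs => hpt s hs.1 (by linarith [hs.2])
  rw [← hval]
  exact hK.mem_of_frequently_of_tendsto hfreq hc.tendsto

lemma exists_rat_abs_eq_rpow {r₁ r₂ : ℝ} {m n : ℤ} (h₁ : r₁ ≠ 0) (h₂ : r₂ ≠ 0) (hn : n ≠ 0)
    (h : n * Real.log |r₁| = m * Real.log |r₂|) : ∃ q : ℚ, |r₁| = |r₂| ^ (q : ℝ) := by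
  refine ⟨m / n, ?_⟩
  have hn' : (n : ℝ) ≠ 0 := Int.cast_ne_zero.2 hn
  rw [Real.rpow_def_of_pos (abs_pos.2 h₂), ← Real.exp_log (abs_pos.2 h₁)]
  congr 1
  push_cast
  field_simp
  linarith

lemma log_abs_neg_of_hasCommonRatio {Ψ : WeightedIFS} {r : ℝ} (hr : Ψ.HasCommonRatio r) :
    Real.log |r| < 0 :=
  Real.log_neg (abs_pos.2 hr.ne_zero) hr.abs_lt_one

/-- If the support has the no-interval property at its minimum, the group of homotheties that
preserve its germ there is cyclic. It contains the homothety of ratio `r ^ 2` for every homogeneous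
generating system of ratio `r`. -/
lemma exists_rat_of_noInterval {Ψ₁ Ψ₂ : WeightedIFS} {r₁ r₂ : ℝ} {μ : Measure ℝ}
    (hμ₁ : Ψ₁.IsSelfSimilarMeasure μ) (hμ₂ : Ψ₂.IsSelfSimilarMeasure μ)
    (hr₁ : Ψ₁.HasCommonRatio r₁) (hr₂ : Ψ₂.HasCommonRatio r₂)
    (hno : NoIntervalCondition μ.support) : ∃ q : ℚ, |r₁| = |r₂| ^ (q : ℝ) := by
  have hleast : IsLeast μ.support (sInf μ.support) :=
    (hμ₁.isCompact_support hr₁).isLeast_sInf hμ₁.nonempty_support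
  have hlog (r : ℝ) : Real.log (r ^ 2) = 2 * Real.log |r| := by
    rw [← sq_abs, Real.log_pow]; norm_num
  have key {Ψ : WeightedIFS} {r : ℝ} (hμ : Ψ.IsSelfSimilarMeasure μ) (hr : Ψ.HasCommonRatio r) :=
    eventually_mem_homothety_iff (pow_pos (abs_pos.2 hr.ne_zero) 2) hleast
      (by simpa only [sq_abs] using hμ.mem_support_iff_sq hr)
  have hmem {Ψ : WeightedIFS} {r : ℝ} (hμ : Ψ.IsSelfSimilarMeasure μ) (hr : Ψ.HasCommonRatio r) :
      2 * Real.log |r| ∈ germScaling μ.support (sInf μ.support) := by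
    have h := (key hμ hr).2
    rwa [← Real.exp_log (pow_pos (abs_pos.2 hr.ne_zero) 2), sq_abs, hlog] at h
  rcases AddSubgroup.dense_or_cyclic (germScaling μ.support (sInf μ.support)) with hd | ⟨c, hc⟩
  · obtain ⟨x, hx, hxne⟩ := (hμ₁.nontrivial_support hr₁).exists_ne (sInf μ.support)
    have hpos : 0 < x - sInf μ.support := sub_pos.2 (lt_of_le_of_ne (hleast.2 hx) hxne.symm)
    obtain ⟨ε, hε, hsub⟩ := exists_Icc_subset_of_dense_germScaling Measure.isClosed_support
      hleast.1 hpos (by simpa using hx) (pow_pos (abs_pos.2 hr₁.ne_zero) 2)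
      (pow_lt_one₀ (abs_nonneg _) hr₁.abs_lt_one two_ne_zero) (key hμ₁ hr₁).1 (key hμ₁ hr₁).2 hd
    exact absurd hsub (hno ε hε)
  · have h1 := hmem hμ₁ hr₁
    have h2 := hmem hμ₂ hr₂
    rw [hc, AddSubgroup.mem_closure_singleton] at h1 h2
    obtain ⟨m, hm⟩ := h1
    obtain ⟨n, hn⟩ := h2
    rw [zsmul_eq_mul] at hm hn
    refine exists_rat_abs_eq_rpow (m := m) (n := n) hr₁.ne_zero hr₂.ne_zero ?_ ?_
    · rintro rfl
      have := log_abs_neg_of_hasCommonRatio hr₂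
      rw [Int.cast_zero, zero_mul] at hn
      linarith
    · linear_combination (m / 2 : ℝ) * hn - (n / 2 : ℝ) * hm

/-! ### Zeros of exponential polynomials on a line -/

/-- On the ray through a point of positive real part, the term of largest frequency dominates an
exponential polynomial. -/
lemma eventually_expSum_ne_zero {n : ℕ} (hn : 0 < n) {b p : Fin n → ℝ}
    (hb : Function.Injective b) (hp : ∀ j, 0 < p j) {z : ℂ} (hz : 0 < z.re) :
    ∀ᶠ t : ℝ in atTop, ∑ j, (p j : ℂ) * Complex.exp (b j * (t * z)) ≠ 0 := by
  have : Nonempty (Fin n) := ⟨⟨0, hn⟩⟩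
  obtain ⟨m, hm⟩ := Finite.exists_max b
  have hlim : Tendsto (fun t : ℝ => ∑ j, (p j : ℂ) * Complex.exp ((b j - b m : ℝ) * (t * z)))
      atTop (𝓝 (∑ j, if j = m then (p m : ℂ) else 0)) := by
    refine tendsto_finsetSum _ fun j _ => ?_
    by_cases hj : j = m
    · subst hj
      simp
    · have hlt : b j - b m < 0 := sub_neg.2 (lt_of_le_of_ne (hm j) (hb.ne hj))
      rw [if_neg hj, tendsto_zero_iff_norm_tendsto_zero]
      have hexp : Tendsto (fun t : ℝ => Real.exp ((b j - b m) * z.re * t)) atTop (𝓝 0) :=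
        Real.tendsto_exp_atBot.comp
          (tendsto_id.const_mul_atTop_of_neg (mul_neg_of_neg_of_pos hlt hz))
      have hmul := hexp.const_mul ‖(p j : ℂ)‖
      rw [mul_zero] at hmul
      refine hmul.congr fun t => ?_
      rw [norm_mul, Complex.norm_exp, Complex.re_ofReal_mul, Complex.re_ofReal_mul]
      ring_nf
  rw [Finset.sum_ite_eq' Finset.univ m, if_pos (Finset.mem_univ m)] at hlim
  filter_upwards [hlim.eventually_ne (Complex.ofReal_ne_zero.2 (hp m).ne')] with t ht h0
  refine ht ?_
  calc ∑ j, (p j : ℂ) * Complex.exp ((b j - b m : ℝ) * (t * z))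
      = (∑ j, (p j : ℂ) * Complex.exp (b j * (t * z))) * Complex.exp (-(b m * (t * z))) := by
        rw [Finset.sum_mul]
        refine Finset.sum_congr rfl fun j _ => ?_
        rw [mul_assoc, ← Complex.exp_add]
        push_cast
        ring_nf
    _ = 0 := by rw [h0, zero_mul]

/-- Real analytic functions that do not vanish near `±∞` have finitely many zeros. -/
lemma finite_zeros_of_analytic {h : ℝ → ℂ} (hh : AnalyticOnNhd ℝ h Set.univ)
    (htop : ∀ᶠ t in atTop, h t ≠ 0) (hbot : ∀ᶠ t in atBot, h t ≠ 0) : {t | h t = 0}.Finite := by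
  obtain ⟨A, hA⟩ := eventually_atTop.1 htop
  obtain ⟨B, hB⟩ := eventually_atBot.1 hbot
  by_contra hinf
  have hsub : {t | h t = 0} ⊆ Set.Icc B A := fun t ht =>
    ⟨le_of_not_ge fun hle => hB t hle ht, le_of_not_ge fun hle => hA t hle ht⟩
  obtain ⟨x, -, hx⟩ := Set.Infinite.exists_accPt_of_subset_isCompact hinf isCompact_Icc hsub
  exact hA A le_rfl (hh.eqOn_zero_of_preconnected_of_frequently_eq_zero isPreconnected_univ
    (Set.mem_univ x) (accPt_iff_frequently_nhdsNE.1 hx) (Set.mem_univ A))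

namespace WeightedIFS

variable {Φ : WeightedIFS} {r : ℝ} {μ : Measure ℝ}

lemma HasCommonRatio.finite_expPoly_zeros (hr : Φ.HasCommonRatio r) {z : ℂ} (hz : z.re ≠ 0) :
    {t : ℝ | Φ.expPoly (t * z) = 0}.Finite := by
  have hN : 0 < Φ.N := by have := Φ.two_le; omega
  -- Reversing the sign of `z` and of all frequencies reduces to a positive real part.
  have hpos {w : ℂ} (hw : 0 < w.re) : ∀ᶠ t : ℝ in atTop, Φ.expPoly (t * w) ≠ 0 :=
    eventually_expSum_ne_zero hN hr.trans_injective Φ.weight_pos hw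
  have hneg {w : ℂ} (hw : w.re < 0) : ∀ᶠ t : ℝ in atTop, Φ.expPoly (t * w) ≠ 0 := by
    have h := eventually_expSum_ne_zero (b := fun j => -Φ.trans j) hN
      (neg_injective.comp hr.trans_injective) Φ.weight_pos (z := -w) (by simpa using hw)
    simpa [expPoly] using h
  have htop {w : ℂ} (hw : w.re ≠ 0) : ∀ᶠ t : ℝ in atTop, Φ.expPoly (t * w) ≠ 0 :=
    hw.lt_or_gt.elim hneg hpos
  refine finite_zeros_of_analytic (fun t _ => ?_) (htop hz) ?_
  · have hof : AnalyticAt ℝ (fun t : ℝ => (t : ℂ)) t := Complex.ofRealCLM.analyticAt t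
    unfold expPoly
    refine Finset.analyticAt_fun_sum _ fun j _ => analyticAt_const.mul ?_
    exact analyticAt_cexp.restrictScalars.fun_comp
      (analyticAt_const.mul (hof.mul analyticAt_const) : AnalyticAt ℝ
        (fun t : ℝ => (Φ.trans j : ℂ) * (t * z)) t)
  · have h := tendsto_neg_atBot_atTop.eventually (htop (w := -z) (by simpa using hz))
    simpa using h

/-! ### The Laplace transform of a self-similar measure -/

lemma IsSelfSimilarMeasure.integrable_cexp (hμ : Φ.IsSelfSimilarMeasure μ)
    (hr : Φ.HasCommonRatio r) (z : ℂ) : Integrable (fun x : ℝ => Complex.exp (z * x)) μ := by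
  have := hμ.1
  obtain ⟨R, hR⟩ := hμ.exists_ae_abs_le hr
  refine Integrable.of_bound (C := Real.exp (‖z‖ * R)) (by fun_prop) ?_
  filter_upwards [hR] with x hx
  rw [Complex.norm_exp, Real.exp_le_exp]
  refine (Complex.re_le_norm _).trans ?_
  rw [norm_mul, Complex.norm_real, Real.norm_eq_abs]
  gcongr

lemma IsSelfSimilarMeasure.complexMGF_eq (hμ : Φ.IsSelfSimilarMeasure μ)
    (hr : Φ.HasCommonRatio r) (z : ℂ) :
    ProbabilityTheory.complexMGF id μ z =
      Φ.expPoly z * ProbabilityTheory.complexMGF id μ (r * z) := by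
  have hmap (j : Fin Φ.N) : AEMeasurable (Φ.map j) μ := (Φ.continuous_map j).aemeasurable
  have hint (j : Fin Φ.N) :
      Integrable (fun x : ℝ => Complex.exp (z * x)) (Measure.map (Φ.map j) μ) := by
    rw [integrable_map_measure (by fun_prop) (hmap j)]
    refine ((hμ.integrable_cexp hr (r * z)).const_mul (Complex.exp (Φ.trans j * z))).congr
      (Eventually.of_forall fun x => ?_)
    simp only [Function.comp_apply, hr.map_apply, ← Complex.exp_add]
    push_cast
    ring_nf
  simp only [ProbabilityTheory.complexMGF, id_eq]
  conv_lhs => rw [hμ.2]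
  rw [integral_finsetSum_measure fun j _ => (hint j).smul_measure ENNReal.ofReal_ne_top, expPoly,
    Finset.sum_mul]
  refine Finset.sum_congr rfl fun j _ => ?_
  rw [integral_smul_measure, integral_map (hmap j) (by fun_prop),
    ENNReal.toReal_ofReal (Φ.weight_pos j).le, Complex.real_smul, mul_assoc]
  simp only [← integral_const_mul, hr.map_apply]
  refine integral_congr_ae (Eventually.of_forall fun x => ?_)
  dsimp only
  rw [← Complex.exp_add]
  push_cast
  ring_nf

lemma IsSelfSimilarMeasure.eventually_complexMGF_ne_zero (hμ : Φ.IsSelfSimilarMeasure μ)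
    (hr : Φ.HasCommonRatio r) :
    ∀ᶠ z in 𝓝 (0 : ℂ), ProbabilityTheory.complexMGF id μ z ≠ 0 := by
  have := hμ.1
  have hset : ProbabilityTheory.integrableExpSet id μ = Set.univ := by
    refine Set.eq_univ_of_forall fun t => ?_
    have h := (hμ.integrable_cexp hr t).norm
    simpa [ProbabilityTheory.integrableExpSet, Complex.norm_exp] using h
  have hc : ContinuousAt (ProbabilityTheory.complexMGF id μ) 0 :=
    (ProbabilityTheory.analyticAt_complexMGF (by simp [hset])).continuousAt
  refine hc.eventually_ne ?_
  simp [ProbabilityTheory.complexMGF]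

/-- Iterating `M z = f z * M (r z)` until `r ^ l * z` is close to `0`, where `M` does not vanish,
puts a zero of `f` at some `r ^ l * z`. -/
lemma IsSelfSimilarMeasure.exists_expPoly_eq_zero (hμ : Φ.IsSelfSimilarMeasure μ)
    (hr : Φ.HasCommonRatio r) {z : ℂ} (hz : ProbabilityTheory.complexMGF id μ z = 0) :
    ∃ l : ℕ, Φ.expPoly ((r : ℂ) ^ l * z) = 0 := by
  by_contra! hne
  have hall (n : ℕ) : ProbabilityTheory.complexMGF id μ ((r : ℂ) ^ n * z) = 0 := by
    induction n with
    | zero => simpa using hz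
    | succ n ih =>
      rw [hμ.complexMGF_eq hr, mul_eq_zero, ← mul_assoc, ← pow_succ'] at ih
      exact ih.resolve_left (hne n)
  have hlim : Tendsto (fun n : ℕ => (r : ℂ) ^ n * z) atTop (𝓝 0) := by
    simpa using (tendsto_pow_atTop_nhds_zero_of_norm_lt_one
      (x := (r : ℂ)) (by simpa using hr.abs_lt_one)).mul_const z
  obtain ⟨n, hn⟩ := (hlim.eventually (hμ.eventually_complexMGF_ne_zero hr)).exists
  exact hn (hall n)

lemma IsSelfSimilarMeasure.complexMGF_zero_div_pow (hμ : Φ.IsSelfSimilarMeasure μ)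
    (hr : Φ.HasCommonRatio r) {z : ℂ} (hz : ProbabilityTheory.complexMGF id μ z = 0) (k : ℕ) :
    ProbabilityTheory.complexMGF id μ ((r : ℂ)⁻¹ ^ k * z) = 0 := by
  induction k with
  | zero => simpa using hz
  | succ k ih =>
    have h0 : (r : ℂ) ≠ 0 := Complex.ofReal_ne_zero.2 hr.ne_zero
    rw [hμ.complexMGF_eq hr, pow_succ', ← mul_assoc, mul_inv_cancel_left₀ h0, ih, mul_zero]

end WeightedIFS

/-! ### Commensurability of the ratios -/

/-- If the Laplace transform of `μ` vanishes at `z` off the imaginary axis, it vanishes at all the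
points `r₁⁻¹ ^ k * z`. Each of them is carried by a power of `r₂` to one of the finitely many
zeros of the second exponential polynomial on the line `ℝ z`, so two of them end up at the same place. -/
lemma exists_rat_of_complexMGF_eq_zero {Ψ₁ Ψ₂ : WeightedIFS} {r₁ r₂ : ℝ} {μ : Measure ℝ}
    (hμ₁ : Ψ₁.IsSelfSimilarMeasure μ) (hμ₂ : Ψ₂.IsSelfSimilarMeasure μ)
    (hr₁ : Ψ₁.HasCommonRatio r₁) (hr₂ : Ψ₂.HasCommonRatio r₂) {z : ℂ} (hz : z.re ≠ 0)
    (hzero : ProbabilityTheory.complexMGF id μ z = 0) : ∃ q : ℚ, |r₁| = |r₂| ^ (q : ℝ) := by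
  choose l hl using fun k => hμ₂.exists_expPoly_eq_zero hr₂ (hμ₁.complexMGF_zero_div_pow hr₁ hzero k)
  have hmaps (k : ℕ) : r₂ ^ l k * r₁⁻¹ ^ k ∈ {t : ℝ | Ψ₂.expPoly (t * z) = 0} := by
    rw [Set.mem_ofPred_eq, ← hl k]
    push_cast
    rw [mul_assoc]
  obtain ⟨k, -, k', -, hkk', heq⟩ := Set.infinite_univ.exists_ne_map_eq_of_mapsTo
    (fun k _ => hmaps k) (hr₂.finite_expPoly_zeros hz)
  have hlog (k : ℕ) : Real.log |r₂ ^ l k * r₁⁻¹ ^ k| =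
      l k * Real.log |r₂| - k * Real.log |r₁| := by
    rw [abs_mul, abs_pow, abs_pow, abs_inv, Real.log_mul, Real.log_pow, Real.log_pow, Real.log_inv]
    · ring
    · exact pow_ne_zero _ (abs_ne_zero.2 hr₂.ne_zero)
    · exact pow_ne_zero _ (inv_ne_zero (abs_ne_zero.2 hr₁.ne_zero))
  have h := congrArg (fun t => Real.log |t|) heq
  simp only [hlog] at h
  refine exists_rat_abs_eq_rpow (m := (l k : ℤ) - l k') (n := (k : ℤ) - k')
    hr₁.ne_zero hr₂.ne_zero (sub_ne_zero.2 (by exact_mod_cast hkk')) ?_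
  push_cast
  linear_combination -h

theorem theorem1p3 (Φ : WeightedIFS) (hΦ : Φ.IsHomogeneous) (hZ : Φ.ConditionZ)
    (μ : Measure ℝ) (hμ : Φ.IsSelfSimilarMeasure μ) : HLC μ := by
  obtain ⟨r, hr⟩ := hΦ
  intro Ψ₁ Ψ₂ r₁ r₂ hμ₁ hμ₂ hr₁ hr₂
  rcases hZ with ⟨K, hK, hno⟩ | ⟨z, hfz, hz⟩
  · rw [← hμ.support_eq_of_isAttractor hr hK] at hno
    exact exists_rat_of_noInterval hμ₁ hμ₂ hr₁ hr₂ hno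
  · exact exists_rat_of_complexMGF_eq_zero hμ₁ hμ₂ hr₁ hr₂ hz
      (by rw [hμ.complexMGF_eq hr, hfz, zero_mul])
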